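/- A constellation of length $k$ on a finite non-empty set $D$ of darts is a sequence $C=[g_1,\dots,g_k]$ of permutations of $D$ such that the group $\langle g_1,\dots,g_k\rangle$ acts transitively on $D$ and $g_1g_2\cdots g_k=\mathrm{id}$. An isomorphism from $[g_1,\dots,g_k]$ on $D$ to $[g_1',\dots,g_k']$ on $D'$ is a bijection $T\colon D\to D'$ with $Tg_i=g_i'T$ for all $i$; $\mathrm{Aut}\,C$ is the group of all isomorphisms from $C$ to itself. For a finite group $\Gamma$, let $f_{\Gamma,k}(n)$ be the number of isomorphism classes of constellations $C$ of length $k$ on exactly $n$ darts with $\mathrm{Aut}\,C\cong\Gamma$. **Theorem.** For any finite group $\Gamma$ and any $k\ge 3$ there exist constants $A_1,B_1,A_2,B_2>0$ and $N\in\mathbb{N}$ (depending only on $\Gamma$ and $k$) such that for all $n\ge N$: 1. $f_{\Gamma,k}(n)\le A_2\,n^{B_2n}$, and if moreover $|\Gamma|$ divides $n$, then $A_1\,n^{B_1n}\le f_{\Gamma,k}(n)$; 2. $A_1\,n^{B_1n}\le\sum_{m=0}^{n} f_{\Gamma,k}(m)\le A_2\,n^{B_2n}$. That is, the number of non-isomorphic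 length-$k$ constellations with automorphism group $\Gamma$ has rate of growth $n^n$, both on exactly $n$ darts, with $n$ running through the multiples of $|\Gamma|$, and on at most $n$ darts, with $n$ arbitrary. -/

import Mathlib

/-- A constellation of length `k` on the dart set `D`: a sequence of `k` permutations of the
non-empty set `D` that generate a transitive group and whose product is the identity. -/
structure Constellation (k : ℕ) (D : Type) where
  /-- the permutations `g₁, …, g_k` -/
  perm : Fin k → Equiv.Perm D
  nonempty : Nonempty D
  transitive : ∀ x y : D, ∃ h ∈ Subgroup.closure (Set.range perm), h x = y
  prod_eq_one : (List.ofFn perm).prod = 1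

namespace Constellation

variable {k : ℕ} {D D' : Type}

/-- The bijection `T` of dart sets is an isomorphism: `T gᵢ = gᵢ' T` for every `i`. -/
def IsIso (C : Constellation k D) (C' : Constellation k D') (T : D ≃ D') : Prop :=
  ∀ i x, T (C.perm i x) = C'.perm i (T x)

/-- The automorphism group: all self-isomorphisms, under composition. -/
def Aut (C : Constellation k D) : Subgroup (Equiv.Perm D) where
  carrier := {T | C.IsIso C T}
  one_mem' := fun _ _ => rfl
  mul_mem' := by
    intro S T hS hT i x
    rw [Equiv.Perm.mul_apply, Equiv.Perm.mul_apply, hT i x, hS i (T x)]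
  inv_mem' := by
    intro T hT i x
    have h := hT i (T.symm x)
    rw [Equiv.apply_symm_apply] at h
    exact (Equiv.symm_apply_eq T).2 h.symm

/-- Isomorphism as an equivalence relation on the constellations of length `k` with dart
set `D`. -/
def isoSetoid (k : ℕ) (D : Type) : Setoid (Constellation k D) where
  r C C' := ∃ T : D ≃ D, C.IsIso C' T
  iseqv :=
    { refl := fun _ => ⟨Equiv.refl D, fun _ _ => rfl⟩
      symm := by
        rintro C C' ⟨T, hT⟩
        refine ⟨T.symm, fun i x => ?_⟩
        rw [Equiv.symm_apply_eq, hT, Equiv.apply_symm_apply]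
      trans := by
        rintro C C' C'' ⟨S, hS⟩ ⟨T, hT⟩
        refine ⟨S.trans T, fun i x => ?_⟩
        rw [Equiv.trans_apply, Equiv.trans_apply, hS, hT] }

/-- Isomorphism classes of constellations of length `k` on `n` darts. Every `n`-element dart set
may be renamed to `Fin n`. -/
abbrev IsoClass (k n : ℕ) : Type := Quotient (isoSetoid k (Fin n))

/-- The isomorphism classes of constellations `C` of length `k` on `n` darts with
`Aut C ≅ Γ`. -/
def classesWithAut (Γ : Type*) [Group Γ] (k n : ℕ) : Set (IsoClass k n) :=
  {q | ∃ C : Constellation k (Fin n), Quotient.mk (isoSetoid k (Fin n)) C = q ∧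
    Nonempty (C.Aut ≃* Γ)}

theorem perm_injective : Function.Injective (perm : Constellation k D → Fin k → Equiv.Perm D) := by
  rintro ⟨_, _, _, _⟩ ⟨_, _, _, _⟩ h
  cases h
  rfl

instance [Finite D] : Finite (Constellation k D) :=
  Finite.of_injective _ perm_injective

/-- There are only finitely many classes, so that counting them by `Set.ncard` is meaningful. -/
theorem finite_classesWithAut (Γ : Type*) [Group Γ] (k n : ℕ) :
    (classesWithAut Γ k n).Finite := Set.toFinite _

/-- The number of non-isomorphic constellations `C` of length `k` on exactly `n` darts with
`Aut C ≅ Γ`. -/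
noncomputable def numWithAut (Γ : Type*) [Group Γ] (k n : ℕ) : ℕ :=
  (classesWithAut Γ k n).ncard

end Constellation

/-! Upper bound: a constellation is a `k`-tuple of permutations, so there are at most `(n!)^k`
classes on `n` darts. Lower bound: take a `Γ`-cover of `Fin (m + 1)`, given by the rotation with
trivial voltages and a permutation `σ`, fixing only `0`, with surjective voltages `v`, `v 0 = 1`.
Left translations by `Γ` are automorphisms. Any isomorphism between two such covers preserves the
fibre over `0`, where the fixed darts of the second permutation lie. Since automorphisms act freely,
there are none beyond `Γ` (`nonempty_aut_cover_mulEquiv`). Compatibility with the rotation then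
makes all second coordinates invariant, so distinct `σ` give non-isomorphic covers
(`IsIso.cover_eq`). The choices of `σ` are the derangements of `m` points, at least `(m - 1)!` of
them for `m ≥ 2`, on `|Γ|(m + 1)` darts. -/

namespace Constellation

variable {k : ℕ} {D D' : Type}

/-- Renaming the darts of a constellation along a bijection. -/
def rename (C : Constellation k D) (e : D ≃ D') : Constellation k D' where
  perm i := e.permCongrHom (C.perm i)
  nonempty := C.nonempty.map e
  transitive x y := by
    obtain ⟨h, hh, hxy⟩ := C.transitive (e.symm x) (e.symm y)
    refine ⟨e.permCongrHom h, ?_, ?_⟩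
    · have := Subgroup.mem_map_of_mem e.permCongrHom.toMonoidHom hh
      rw [MonoidHom.map_closure, ← Set.range_comp] at this
      exact this
    · simp [Equiv.permCongrHom, hxy]
  prod_eq_one := by
    have := congrArg e.permCongrHom C.prod_eq_one
    rw [map_one, map_list_prod, List.map_ofFn] at this
    exact this

theorem isIso_rename (C : Constellation k D) (e : D ≃ D') : C.IsIso (C.rename e) e := by
  intro i x
  simp [rename, Equiv.permCongrHom]

theorem IsIso.symm {C : Constellation k D} {C' : Constellation k D'} {T : D ≃ D'}
    (h : C.IsIso C' T) : C'.IsIso C T.symm := fun i x => by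
  rw [Equiv.symm_apply_eq, h, Equiv.apply_symm_apply]

theorem IsIso.trans {D'' : Type} {C : Constellation k D} {C' : Constellation k D'}
    {C'' : Constellation k D''} {S : D ≃ D'} {T : D' ≃ D''}
    (hS : C.IsIso C' S) (hT : C'.IsIso C'' T) : C.IsIso C'' (S.trans T) := fun i x => by
  rw [Equiv.trans_apply, Equiv.trans_apply, hS, hT]

/-- Isomorphic constellations have isomorphic automorphism groups. -/
def autCongr {C : Constellation k D} {C' : Constellation k D'} {e : D ≃ D'}
    (h : C.IsIso C' e) : C.Aut ≃* C'.Aut where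
  toFun T := ⟨e.permCongrHom T, (h.symm.trans (T := (T : Equiv.Perm D)) T.2).trans h⟩
  invFun T := ⟨e.symm.permCongrHom T, (h.trans (T := (T : Equiv.Perm D')) T.2).trans h.symm⟩
  left_inv T := by ext; simp [Equiv.permCongrHom]
  right_inv T := by ext; simp [Equiv.permCongrHom]
  map_mul' S T := by ext; simp [Equiv.permCongrHom]

/-- The automorphism group acts freely on the darts. -/
theorem eq_one_of_mem_aut (C : Constellation k D) {T : Equiv.Perm D} (hT : T ∈ C.Aut) {x : D}
    (hx : T x = x) : T = 1 := by
  -- `T` commutes with the generators, hence with the whole transitive group; so fixing `x` forces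
  -- it to fix every `h x`.
  have hle : Subgroup.closure (Set.range C.perm) ≤ Subgroup.centralizer {T} := by
    rw [Subgroup.closure_le]
    rintro _ ⟨i, rfl⟩
    rw [SetLike.mem_coe, Subgroup.mem_centralizer_singleton_iff]
    ext y
    exact (hT i y).symm
  ext y
  obtain ⟨h, hh, rfl⟩ := C.transitive x y
  have := Subgroup.mem_centralizer_singleton_iff.1 (hle hh)
  rw [← Equiv.Perm.mul_apply, ← this, Equiv.Perm.mul_apply, hx, Equiv.Perm.one_apply]

/-- The constellation of length `k + 3` whose first two permutations are `a` and `b`, whose third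
is `(a * b)⁻¹`, and whose other permutations are trivial. -/
def ofPair (k : ℕ) [Nonempty D] (a b : Equiv.Perm D)
    (h : ∀ x y : D, ∃ g ∈ Subgroup.closure {a, b}, g x = y) : Constellation (k + 3) D where
  perm := Fin.cons a (Fin.cons b (Fin.cons (a * b)⁻¹ fun _ => 1))
  nonempty := ‹_›
  transitive x y := by
    obtain ⟨g, hg, hxy⟩ := h x y
    refine ⟨g, Subgroup.closure_mono ?_ hg, hxy⟩
    rintro _ (rfl | rfl)
    · exact ⟨0, rfl⟩
    · exact ⟨1, rfl⟩
  prod_eq_one := by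
    simp only [List.ofFn_succ, Fin.cons_zero, Fin.cons_succ, List.prod_cons]
    simp

/-! ### Covers with voltages in `Γ` -/

section Cover

open scoped Fin.NatCast

variable {Γ : Type} [Group Γ] {m : ℕ}

/-- The permutation of `Γ × Fin (m + 1)` over the permutation `σ` of `Fin (m + 1)` with
voltages `v`. -/
def voltagePerm (v : Fin (m + 1) → Γ) (σ : Equiv.Perm (Fin (m + 1))) :
    Equiv.Perm (Γ × Fin (m + 1)) where
  toFun x := (x.1 * v x.2, σ x.2)
  invFun x := (x.1 * (v (σ.symm x.2))⁻¹, σ.symm x.2)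
  left_inv x := by simp
  right_inv x := by simp

@[simp]
theorem voltagePerm_apply (v : Fin (m + 1) → Γ) (σ : Equiv.Perm (Fin (m + 1)))
    (x : Γ × Fin (m + 1)) : voltagePerm v σ x = (x.1 * v x.2, σ x.2) := rfl

/-- The rotation of the second factor. -/
def rotation (Γ : Type) [Group Γ] (m : ℕ) : Equiv.Perm (Γ × Fin (m + 1)) :=
  voltagePerm (fun _ => 1) (Equiv.addRight 1)

@[simp]
theorem rotation_apply (x : Γ × Fin (m + 1)) : rotation Γ m x = (x.1, x.2 + 1) := by
  simp [rotation]

theorem rotation_pow_apply (j : ℕ) (γ : Γ) (i : Fin (m + 1)) :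
    (rotation Γ m ^ j) (γ, i) = (γ, i + (j : Fin (m + 1))) := by
  induction j with
  | zero => simp
  | succ j ih => rw [pow_succ', Equiv.Perm.mul_apply, ih]; simp [add_assoc]

theorem transitive_closure_rotation_voltagePerm {v : Fin (m + 1) → Γ}
    (hv : Function.Surjective v) (σ : Equiv.Perm (Fin (m + 1))) (x y : Γ × Fin (m + 1)) :
    ∃ g ∈ Subgroup.closure {rotation Γ m, voltagePerm v σ}, g x = y := by
  have ha : rotation Γ m ∈ Subgroup.closure {rotation Γ m, voltagePerm v σ} :=
    Subgroup.subset_closure (by simp)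
  have hb : voltagePerm v σ ∈ Subgroup.closure {rotation Γ m, voltagePerm v σ} :=
    Subgroup.subset_closure (by simp)
  have hrot : ∀ i j : Fin (m + 1), ∃ l : ℕ, ∀ γ : Γ, (rotation Γ m ^ l) (γ, i) = (γ, j) :=
    fun i j => ⟨(j - i : Fin (m + 1)).val, fun γ => by
      rw [rotation_pow_apply, Fin.cast_val_eq_self, add_sub_cancel]⟩
  -- Rotations leave the `Γ`-coordinate alone, so one voltage step suffices: rotate to an index
  -- carrying the required voltage, apply it, rotate to the target index.
  obtain ⟨i, hi⟩ := hv (x.1⁻¹ * y.1)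
  obtain ⟨p, hp⟩ := hrot x.2 i
  obtain ⟨q, hq⟩ := hrot (σ i) y.2
  refine ⟨rotation Γ m ^ q * (voltagePerm v σ * rotation Γ m ^ p),
    mul_mem (pow_mem ha q) (mul_mem hb (pow_mem ha p)), ?_⟩
  rw [Equiv.Perm.mul_apply, Equiv.Perm.mul_apply, ← Prod.mk.eta (p := x), hp, voltagePerm_apply]
  simp [hi, hq]

/-- The constellation with voltages `v` over the pair formed by the rotation and `σ`. -/
def cover (k : ℕ) {v : Fin (m + 1) → Γ} (hv : Function.Surjective v)
    (σ : Equiv.Perm (Fin (m + 1))) : Constellation (k + 3) (Γ × Fin (m + 1)) :=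
  ofPair k (rotation Γ m) (voltagePerm v σ) (transitive_closure_rotation_voltagePerm hv σ)

variable {v : Fin (m + 1) → Γ} (hv : Function.Surjective v) {σ τ : Equiv.Perm (Fin (m + 1))}

theorem IsIso.cover_rotation {T : Equiv.Perm (Γ × Fin (m + 1))}
    (hT : (cover k hv σ).IsIso (cover k hv τ) T) (x : Γ × Fin (m + 1)) :
    T (rotation Γ m x) = rotation Γ m (T x) := hT 0 x

theorem IsIso.cover_voltagePerm {T : Equiv.Perm (Γ × Fin (m + 1))}
    (hT : (cover k hv σ).IsIso (cover k hv τ) T) (x : Γ × Fin (m + 1)) :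
    T (voltagePerm v σ x) = voltagePerm v τ (T x) := hT 1 x

/-- If `0` is the only fixed point of `τ`, isomorphisms preserve the fibre over `0`. -/
theorem IsIso.cover_apply_zero {T : Equiv.Perm (Γ × Fin (m + 1))} (hv0 : v 0 = 1) (hσ : σ 0 = 0)
    (hτ : ∀ i, τ i = i → i = 0)
    (hT : (cover k hv σ).IsIso (cover k hv τ) T) (γ : Γ) : (T (γ, 0)).2 = 0 := by
  -- The dart `(γ, 0)` is fixed by `voltagePerm v σ`, so its image is fixed by `voltagePerm v τ` and
  -- lies over a fixed point of `τ`.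
  have h := hT.cover_voltagePerm hv (γ, 0)
  simp only [voltagePerm_apply, hv0, hσ, mul_one] at h
  exact hτ _ (congrArg Prod.snd h).symm

/-- The fibre over `0` is preserved, and every other fibre is a rotation of it. Hence `T` preserves
all second coordinates, and comparing those of the second permutations identifies `σ` with `τ`. -/
theorem IsIso.cover_eq {T : Equiv.Perm (Γ × Fin (m + 1))} (hv0 : v 0 = 1) (hσ : σ 0 = 0)
    (hτ : ∀ i, τ i = i → i = 0)
    (hT : (cover k hv σ).IsIso (cover k hv τ) T) : σ = τ := by
  have hpow : ∀ (j : ℕ) (γ : Γ), (T (γ, (j : Fin (m + 1)))).2 = j := by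
    intro j γ
    induction j with
    | zero => simpa using hT.cover_apply_zero hv hv0 hσ hτ γ
    | succ j ih =>
      have h := hT.cover_rotation hv (γ, (j : Fin (m + 1)))
      simp only [rotation_apply] at h
      rw [Nat.cast_succ, h, ih]
  have hsnd : ∀ x, (T x).2 = x.2 := fun x => by
    have := hpow x.2.val x.1
    rwa [Fin.cast_val_eq_self] at this
  ext i : 1
  have h := congrArg Prod.snd (hT.cover_voltagePerm hv (1, i))
  rw [hsnd] at h
  simpa [hsnd] using h

theorem nonempty_aut_cover_mulEquiv (hv0 : v 0 = 1) (hσ : ∀ i, σ i = i ↔ i = 0) :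
    Nonempty ((cover k hv σ).Aut ≃* Γ) := by
  -- Left translations commute with the voltages, which multiply on the right.
  let L : Γ →* Equiv.Perm (Γ × Fin (m + 1)) :=
    { toFun := fun γ => (Equiv.mulLeft γ).prodCongr (Equiv.refl _)
      map_one' := by ext <;> simp
      map_mul' := fun a b => by ext <;> simp [mul_assoc] }
  have hL : ∀ γ x, L γ x = (γ * x.1, x.2) := fun γ x => rfl
  have hmem : ∀ γ, L γ ∈ (cover k hv σ).Aut := by
    intro γ i x
    have hrot : L γ * rotation Γ m = rotation Γ m * L γ := by ext <;> simp [hL]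
    have hvol : L γ * voltagePerm v σ = voltagePerm v σ * L γ := by
      ext <;> simp [hL, mul_assoc]
    suffices h : L γ * (cover k hv σ).perm i = (cover k hv σ).perm i * L γ from
      Equiv.congr_fun h x
    change Commute _ _ at hrot hvol
    change Commute (L γ) _
    refine Fin.cases hrot (fun i => Fin.cases hvol (fun i => Fin.cases ?_ (fun i => ?_) i) i) i
    · exact (hrot.mul_right hvol).inv_right
    · exact Commute.one_right _
  refine ⟨(MulEquiv.ofBijective (L.codRestrict _ hmem) ⟨?_, ?_⟩).symm⟩
  · intro a b h
    have := Equiv.congr_fun (congrArg Subtype.val h) (1, 0)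
    simpa [hL] using this
  · rintro ⟨T, hT⟩
    have h0 := IsIso.cover_apply_zero hv hv0 ((hσ 0).2 rfl) (fun i => (hσ i).1) hT 1
    refine ⟨(T (1, 0)).1, Subtype.ext ?_⟩
    -- By freeness, `T` equals the translation agreeing with it at `(1, 0)`.
    have hfix : ((L (T (1, 0)).1)⁻¹ * T) (1, 0) = (1, 0) := by
      rw [Equiv.Perm.mul_apply, Equiv.Perm.inv_eq_iff_eq, hL]
      ext <;> simp [h0]
    exact inv_mul_eq_one.1 (eq_one_of_mem_aut _ (mul_mem (inv_mem (hmem _)) hT) hfix)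

end Cover

/-! ### Bounds for the number of classes -/

theorem numWithAut_congr {Γ Γ' : Type*} [Group Γ] [Group Γ'] (e : Γ ≃* Γ') (k n : ℕ) :
    numWithAut Γ k n = numWithAut Γ' k n := by
  unfold numWithAut classesWithAut
  congr! 6 with q C
  exact ⟨fun ⟨f⟩ => ⟨f.trans e⟩, fun ⟨f⟩ => ⟨f.trans e.symm⟩⟩

theorem _root_.Function.exists_surjective_fin_eq_one {Γ : Type*} [Group Γ] [Finite Γ] {m : ℕ}
    (h : Nat.card Γ ≤ m + 1) : ∃ v : Fin (m + 1) → Γ, Function.Surjective v ∧ v 0 = 1 := by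
  have f : Γ ↪ Fin (m + 1) := (Finite.equivFin Γ).toEmbedding.trans (Fin.castLEEmb h)
  have hs := Function.invFun_surjective f.injective
  -- Left division by the value at `0` normalises a surjection without losing surjectivity.
  refine ⟨fun i => (Function.invFun f 0)⁻¹ * Function.invFun f i, fun γ => ?_, by simp⟩
  obtain ⟨i, hi⟩ := hs (Function.invFun f 0 * γ)
  exact ⟨i, by simp [hi]⟩

theorem numDerangements_le_numWithAut_of_type_zero (Γ : Type) [Group Γ] [Finite Γ] (k : ℕ) {m : ℕ}
    (h : Nat.card Γ ≤ m + 1) :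
    numDerangements m ≤ numWithAut Γ (k + 3) (Nat.card Γ * (m + 1)) := by
  obtain ⟨v, hv, hv0⟩ := Function.exists_surjective_fin_eq_one h
  let e : Γ × Fin (m + 1) ≃ Fin (Nat.card Γ * (m + 1)) :=
    ((Finite.equivFin Γ).prodCongr (Equiv.refl _)).trans finProdFinEquiv
  -- Extending a derangement of the nonzero indices by the identity makes `0` the unique fixed
  -- point.
  let s : derangements {i : Fin (m + 1) // i ≠ 0} → Equiv.Perm (Fin (m + 1)) :=
    fun τ => Equiv.Perm.ofSubtype τ.1
  have hs : ∀ τ i, s τ i = i ↔ i = 0 := by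
    intro τ i
    by_cases hi : i = 0
    · simp only [hi, iff_true]
      exact Equiv.Perm.ofSubtype_apply_of_not_mem _ (by simp)
    · simp only [hi, iff_false]
      intro h
      have h2 := Equiv.Perm.ofSubtype_apply_of_mem τ.1 (a := i) hi
      exact τ.2 ⟨i, hi⟩ (Subtype.ext (h2.symm.trans h))
  let F : derangements {i : Fin (m + 1) // i ≠ 0} →
      classesWithAut Γ (k + 3) (Nat.card Γ * (m + 1)) := fun τ =>
    ⟨Quotient.mk _ ((cover k hv (s τ)).rename e), _, rfl,
      (nonempty_aut_cover_mulEquiv hv hv0 (hs τ)).map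
        (autCongr (isIso_rename (cover k hv (s τ)) e)).symm.trans⟩
  have hF : Function.Injective F := by
    intro τ τ' heq
    obtain ⟨T, hT⟩ := Quotient.exact (congrArg Subtype.val heq)
    have hiso := ((isIso_rename (cover k hv (s τ)) e).trans hT).trans
      (isIso_rename (cover k hv (s τ')) e).symm
    have := hiso.cover_eq hv hv0 ((hs τ 0).2 rfl) (fun i => (hs τ' i).1)
    exact Subtype.ext (Equiv.Perm.ofSubtype_injective this)
  have hcard := Nat.card_le_card_of_injective F hF
  rw [Nat.card_eq_fintype_card, card_derangements_eq_numDerangements] at hcard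
  rw [Nat.card_coe_set_eq] at hcard
  simpa [numWithAut, Fintype.card_subtype_compl] using hcard

theorem numDerangements_le_numWithAut (Γ : Type*) [Group Γ] [Finite Γ] (k : ℕ) {m : ℕ}
    (h : Nat.card Γ ≤ m + 1) :
    numDerangements m ≤ numWithAut Γ (k + 3) (Nat.card Γ * (m + 1)) := by
  -- Dart sets live in `Type`, so the cover is built from a copy of `Γ` there.
  have e : Shrink.{0} Γ ≃* Γ := Shrink.mulEquiv
  have : Finite (Shrink.{0} Γ) := Finite.of_equiv Γ e.symm.toEquiv
  rw [← Nat.card_congr e.toEquiv] at h ⊢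
  rw [← numWithAut_congr e]
  exact numDerangements_le_numWithAut_of_type_zero _ k h

theorem numWithAut_le (Γ : Type*) [Group Γ] (k n : ℕ) : numWithAut Γ k n ≤ n.factorial ^ k := by
  calc numWithAut Γ k n ≤ Nat.card (IsoClass k n) := Set.ncard_le_card _
    _ ≤ Nat.card (Constellation k (Fin n)) :=
      Nat.card_le_card_of_surjective _ Quotient.mk_surjective
    _ ≤ Nat.card (Fin k → Equiv.Perm (Fin n)) := Nat.card_le_card_of_injective _ perm_injective
    _ = n.factorial ^ k := by simp [Nat.card_eq_fintype_card, Fintype.card_perm]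

end Constellation

/-! ### Growth estimates -/

theorem factorial_le_numDerangements (n : ℕ) : (n + 1).factorial ≤ numDerangements (n + 2) := by
  induction n with
  | zero => decide
  | succ n ih =>
    rw [numDerangements_add_two (n + 1), Nat.factorial_succ (n + 1)]
    -- Only the larger-index summand of the recurrence is kept.
    exact Nat.mul_le_mul_left _ (ih.trans (Nat.le_add_left _ _))

theorem rpow_div_eight_le_factorial {m : ℕ} (hm : 9 ≤ m) :
    (m : ℝ) ^ ((m : ℝ) / 8) ≤ ((m - 2).factorial : ℝ) := by
  obtain ⟨h, r, hr, rfl⟩ : ∃ h r : ℕ, r ≤ 1 ∧ m = 2 * h + r + 2 :=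
    ⟨(m - 2) / 2, (m - 2) % 2, by omega, by omega⟩
  have hh : 3 ≤ h := by omega
  -- The top `h + r` factors of `(2h + r)!` are each at least `h + 1`, which is at least `√m`.
  have h1 : (h + 1) ^ (h + r) ≤ (2 * h + r + 2 - 2).factorial := by
    have := Nat.factorial_mul_pow_le_factorial (m := h) (n := h + r)
    rw [show h + (h + r) = 2 * h + r + 2 - 2 by omega] at this
    exact le_trans (Nat.le_mul_of_pos_left _ (Nat.factorial_pos h)) this
  have h2 : 2 * h + r + 2 ≤ (h + 1) ^ 2 := by nlinarith
  have h1' : ((h : ℝ) + 1) ^ (h + r) ≤ ((2 * h + r + 2 - 2).factorial : ℝ) := by exact_mod_cast h1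
  have h2' : ((2 * h + r + 2 : ℕ) : ℝ) ≤ ((h : ℝ) + 1) ^ (2 : ℝ) := by
    rw [Real.rpow_two]; exact_mod_cast h2
  have hr' : (r : ℝ) ≤ 1 := by exact_mod_cast hr
  have hh' : (3 : ℝ) ≤ h := by exact_mod_cast hh
  have hr0 : (0 : ℝ) ≤ r := r.cast_nonneg
  refine le_trans ?_ h1'
  calc ((2 * h + r + 2 : ℕ) : ℝ) ^ (((2 * h + r + 2 : ℕ) : ℝ) / 8)
      ≤ (((h : ℝ) + 1) ^ (2 : ℝ)) ^ (((2 * h + r + 2 : ℕ) : ℝ) / 8) := by gcongr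
    _ = ((h : ℝ) + 1) ^ (2 * (((2 * h + r + 2 : ℕ) : ℝ) / 8)) := by
        rw [Real.rpow_mul (by positivity)]
    _ ≤ ((h : ℝ) + 1) ^ ((h + r : ℕ) : ℝ) := by
        apply Real.rpow_le_rpow_of_exponent_le (by linarith)
        push_cast
        linarith
    _ = ((h : ℝ) + 1) ^ (h + r) := Real.rpow_natCast _ _

theorem rpow_le_numDerangements_div {c n : ℕ} (hc : 0 < c) (hn : c * (c + 10) ≤ n) :
    (n : ℝ) ^ (1 / (32 * c : ℝ) * n) ≤ (numDerangements (n / c - 1) : ℝ) := by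
  have hm : c + 10 ≤ n / c := (Nat.le_div_iff_mul_le hc).2 (by rwa [mul_comm])
  have hlt : n < c * (n / c + 1) := by
    rw [mul_comm]; exact Nat.lt_mul_of_div_lt (Nat.lt_succ_self _) hc
  generalize n / c = m at hm hlt
  -- `c ≤ m - 10` gives `n < c(m + 1) ≤ (m - 10)(m + 1) < m²`. The exponent satisfies `n / (32c) ≤
  -- (m + 1) / 32 ≤ m / 16`, and passing from base `n` to `m²` doubles it to `m / 8`.
  have hnm : n ≤ m ^ 2 := by
    obtain ⟨d, rfl⟩ := Nat.exists_eq_add_of_le hm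
    nlinarith
  have hn1 : 1 ≤ n := le_trans (by nlinarith) hn
  have hfac : ((m - 2).factorial : ℝ) ≤ numDerangements (m - 1) := by
    obtain ⟨d, rfl⟩ := Nat.exists_eq_add_of_le (show 3 ≤ m by omega)
    have := factorial_le_numDerangements d
    rw [show 3 + d - 2 = d + 1 by omega, show 3 + d - 1 = d + 2 by omega]
    exact_mod_cast this
  refine le_trans ?_ ((rpow_div_eight_le_factorial (by omega)).trans hfac)
  have hc' : (0 : ℝ) < c := by exact_mod_cast hc
  have hlt' : (n : ℝ) ≤ c * (m + 1) := by exact_mod_cast hlt.le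
  have hm1 : (1 : ℝ) ≤ m := by exact_mod_cast (by omega : 1 ≤ m)
  calc (n : ℝ) ^ (1 / (32 * c : ℝ) * n) ≤ (n : ℝ) ^ ((m : ℝ) / 16) := by
        apply Real.rpow_le_rpow_of_exponent_le (by exact_mod_cast hn1)
        rw [div_mul_eq_mul_div, one_mul, div_le_div_iff₀ (by positivity) (by norm_num)]
        nlinarith
    _ ≤ ((m : ℝ) ^ (2 : ℝ)) ^ ((m : ℝ) / 16) := by
        have : (n : ℝ) ≤ (m : ℝ) ^ (2 : ℝ) := by rw [Real.rpow_two]; exact_mod_cast hnm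
        gcongr
    _ = (m : ℝ) ^ ((m : ℝ) / 8) := by
        rw [← Real.rpow_mul (by positivity)]; congr 1; ring

theorem mainTheorem5 (Γ : Type*) [Group Γ] [Finite Γ] (k : ℕ) (hk : 3 ≤ k) :
    ∃ A₁ B₁ A₂ B₂ : ℝ, 0 < A₁ ∧ 0 < B₁ ∧ 0 < A₂ ∧ 0 < B₂ ∧ ∃ N : ℕ, ∀ n : ℕ, N ≤ n →
      -- exactly `n` darts
      (Nat.card Γ ∣ n →
        A₁ * (n : ℝ) ^ (B₁ * (n : ℝ)) ≤ (Constellation.numWithAut Γ k n : ℝ)) ∧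
      (Constellation.numWithAut Γ k n : ℝ) ≤ A₂ * (n : ℝ) ^ (B₂ * (n : ℝ)) ∧
      -- at most `n` darts
      A₁ * (n : ℝ) ^ (B₁ * (n : ℝ)) ≤
        ((∑ m ∈ Finset.range (n + 1), Constellation.numWithAut Γ k m : ℕ) : ℝ) ∧
      ((∑ m ∈ Finset.range (n + 1), Constellation.numWithAut Γ k m : ℕ) : ℝ) ≤
        A₂ * (n : ℝ) ^ (B₂ * (n : ℝ)) := by
  have hc : 0 < Nat.card Γ := Nat.card_pos
  -- In `B₂ = k + 1`, the `k` comes from `(n!)^k ≤ n^(kn)` and the extra `1` absorbs the `n + 1 ≤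
  -- n^n` summands.
  refine ⟨1, 1 / (32 * Nat.card Γ), 1, k + 1, one_pos, by positivity, one_pos, by positivity,
    Nat.card Γ * (Nat.card Γ + 10), fun n hn => ?_⟩
  have hm : Nat.card Γ + 10 ≤ n / Nat.card Γ :=
    (Nat.le_div_iff_mul_le hc).2 (by rwa [mul_comm])
  have hn2 : 2 ≤ n := le_trans (by nlinarith) hn
  -- Evaluating at the largest multiple of `|Γ|` up to `n` serves both lower bounds: it is `n`
  -- itself when `|Γ|` divides `n`, and otherwise one term of the sum.
  have hlow : (n : ℝ) ^ (1 / (32 * Nat.card Γ : ℝ) * n) ≤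
      (Constellation.numWithAut Γ k (Nat.card Γ * (n / Nat.card Γ)) : ℝ) := by
    refine (rpow_le_numDerangements_div hc hn).trans (Nat.cast_le.2 ?_)
    obtain ⟨j, rfl⟩ := Nat.exists_eq_add_of_le' hk
    have := Constellation.numDerangements_le_numWithAut Γ j
      (m := n / Nat.card Γ - 1) (by omega)
    rwa [Nat.sub_add_cancel (by omega)] at this
  have hup : ∑ m ∈ Finset.range (n + 1), Constellation.numWithAut Γ k m ≤ n ^ ((k + 1) * n) := by
    calc ∑ m ∈ Finset.range (n + 1), Constellation.numWithAut Γ k m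
        ≤ ∑ _m ∈ Finset.range (n + 1), (n ^ n) ^ k := by
          refine Finset.sum_le_sum fun m hm => (Constellation.numWithAut_le Γ k m).trans ?_
          gcongr
          exact (Nat.factorial_le (Finset.mem_range_succ_iff.1 hm)).trans
            (Nat.factorial_le_pow n)
      _ = (n + 1) * (n ^ n) ^ k := by simp
      _ ≤ n ^ n * (n ^ n) ^ k := by
          gcongr
          calc n + 1 ≤ n ^ 2 := by nlinarith
            _ ≤ n ^ n := Nat.pow_le_pow_right (by omega) hn2
      _ = n ^ ((k + 1) * n) := by rw [← pow_mul, ← pow_add]; ring_nf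
  have hup' : ((∑ m ∈ Finset.range (n + 1), Constellation.numWithAut Γ k m : ℕ) : ℝ) ≤
      1 * (n : ℝ) ^ (((k : ℝ) + 1) * n) := by
    rw [one_mul, show ((k : ℝ) + 1) * n = (((k + 1) * n : ℕ) : ℝ) by push_cast; ring,
      Real.rpow_natCast]
    exact_mod_cast hup
  have hle : ∀ m ≤ n, Constellation.numWithAut Γ k m ≤
      ∑ m ∈ Finset.range (n + 1), Constellation.numWithAut Γ k m := fun m hm =>
    Finset.single_le_sum (f := Constellation.numWithAut Γ k) (fun _ _ => Nat.zero_le _)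
      (Finset.mem_range_succ_iff.2 hm)
  refine ⟨fun hd => ?_, ?_, ?_, hup'⟩
  · rw [one_mul]
    rwa [Nat.mul_div_cancel' hd] at hlow
  · exact le_trans (Nat.cast_le.2 (hle n le_rfl)) hup'
  · rw [one_mul]
    exact hlow.trans (Nat.cast_le.2 (hle _ (Nat.mul_div_le n _)))
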